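/- Let $\xi_1,\xi_2,\dots$ be independent, identically distributed random variables with values in $\mathbb N=\{1,2,3,\dots\}$ (almost surely), and suppose that the truncated mean $\ell(t):=\mathbb E(\xi_1\wedge t)$ is slowly varying at infinity, i.e. $\ell(ct)/\ell(t)\to1$ as $t\to\infty$ for every $c>0$. Put $s_k:=\sum_{i=1}^k\xi_i$, $u(n):=\sum_{k=1}^nP(s_k=n)$ and $a(n):=\sum_{k=1}^nu(k)$ for $k,n\ge1$. Then $$a(n)\sim\frac n{\ell(n)}\qquad(n\to\infty),$$ that is, the ratio of the two sides tends to $1$; and for every bounded continuous function $g:(0,\infty)\to\mathbb R$, $$\frac1{a(N)}\sum_{n=1}^N\Bigl|\sum_{k=1}^ng\Bigl(\frac k{a(n)}\Bigr)P(s_k=n)-g(1)u(n)\Bigr|\xrightarrow[N\to\infty]{}0.$$ (If $a(n)=0$, then $P(s_k=n)=0$ for all $k\ge1$, and the corresponding summand is read as $0$.) -/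

import Mathlib

open MeasureTheory ProbabilityTheory Filter Topology Asymptotics

/-- A real function `f` is slowly varying at infinity (Karamata): on some half-line `[A, ∞)` it is
positive and measurable, and `f (c * t) / f t → 1` as `t → ∞`, for every `c > 0`. -/
def IsSlowlyVarying (f : ℝ → ℝ) : Prop :=
  (∃ A : ℝ, Measurable (fun t : Set.Ici A => f t) ∧ ∀ t, A ≤ t → 0 < f t) ∧
    ∀ c : ℝ, 0 < c → Tendsto (fun t : ℝ => f (c * t) / f t) atTop (𝓝 1)

namespace Renewal

variable {Ω : Type*} [MeasurableSpace Ω]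

/-- The truncated mean `t ↦ E (X ∧ t)` of an `ℕ`-valued random variable `X`. -/
noncomputable def truncatedMean (P : Measure Ω) (X : Ω → ℕ) (t : ℝ) : ℝ :=
  ∫ ω, min (X ω : ℝ) t ∂P

/-- The sum `s_k` of the first `k` lifetimes; the lifetimes are indexed from `0`. -/
def partialSum (ξ : ℕ → Ω → ℕ) (k : ℕ) (ω : Ω) : ℕ :=
  ∑ i ∈ Finset.range k, ξ i ω

/-- The probability `P (s_k = n)`. -/
noncomputable def hitProb (P : Measure Ω) (ξ : ℕ → Ω → ℕ) (k n : ℕ) : ℝ :=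
  P.real {ω | partialSum ξ k ω = n}

/-- The renewal sequence `u(n) = ∑_{k=1}^n P (s_k = n)`. -/
noncomputable def renewalSeq (P : Measure Ω) (ξ : ℕ → Ω → ℕ) (n : ℕ) : ℝ :=
  ∑ k ∈ Finset.Icc 1 n, hitProb P ξ k n

/-- The return sequence `a(n) = ∑_{k=1}^n u(k)`. -/
noncomputable def returnSeq (P : Measure Ω) (ξ : ℕ → Ω → ℕ) (n : ℕ) : ℝ :=
  ∑ k ∈ Finset.Icc 1 n, renewalSeq P ξ k

end Renewal

/-!
Write `F` for the generating series of the law of a lifetime, `a` for the return sequence and `L`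
for the sum of the first tails, that is, `ℓ` at the integers. Summing the renewal equation
`(1 - F)⁻¹ * (1 - F) = 1` twice and using that `L` increases gives `n ≤ (1 + a(n)) L(n)` and
`(1 + a(n)) L(m) ≤ n + m`. Taking `m = ⌊ε n⌋`, slow variation yields `a(n) ~ n / ℓ(n)`.

The weights `k ↦ P (s_k ≤ n)` lie in `[0, 1]` and have sum `a(n)`, so their first moment is about
`a(n)² / 2` at least, with near equality only if they are close to a sharp cutoff at `a(n)`. This
first moment is a convolution of the renewal sequence with `1 + a`, and the bounds above show that
it is indeed `~ a(n)² / 2`. Hence few numbers of renewals `k` far from `a(N)` can occur at times in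
`(ρ N, N]`: they contribute `o(a(N))` to `∑ u(n)`. As `a(ρ N) ~ ρ a(N)` with `ρ < 1`, iterating
`N ↦ ρ N` extends this to all times up to `N`, and only the values of `g` near `1` matter.
-/

namespace Renewal

open Finset PowerSeries

section GeneratingSeries

/-- The partial sums of the coefficients of a power series: the distribution function of a law
on `ℕ` with generating series `φ`. -/
noncomputable def cumSum {R : Type*} [Semiring R] (φ : R⟦X⟧) (n : ℕ) : R :=
  ∑ i ∈ range (n + 1), coeff i φ

/-- The generating series of the expected number of renewals at each time, for lifetimes with
generating series `F`. It stands for `∑_{k ≥ 1} F ^ k`, provided that the constant coefficient of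
`F` vanishes. -/
noncomputable def renewalSeries {K : Type*} [Field K] (F : K⟦X⟧) : K⟦X⟧ :=
  F * (1 - F)⁻¹

/-- The expected number of renewals in `{1, …, n}` for lifetimes with generating series `F`. -/
noncomputable def renewalFun {K : Type*} [Field K] (F : K⟦X⟧) (n : ℕ) : K :=
  cumSum (renewalSeries F) n

/-- The mean truncated at the integer `n` of a law with generating series `F`, written as the sum
of its first `n` tails. -/
noncomputable def tailSum {R : Type*} [Ring R] (F : R⟦X⟧) (n : ℕ) : R :=
  ∑ m ∈ range n, (1 - cumSum F m)

lemma cumSum_eq_coeff_mul_mk_one {R : Type*} [Semiring R] (φ : R⟦X⟧) (n : ℕ) :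
    cumSum φ n = coeff n (φ * PowerSeries.mk 1) := by
  simp [cumSum, coeff_mul, Nat.sum_antidiagonal_eq_sum_range_succ_mk]

lemma cumSum_mul {R : Type*} [Semiring R] (φ ψ : R⟦X⟧) (n : ℕ) :
    cumSum (φ * ψ) n = ∑ j ∈ range (n + 1), coeff j φ * cumSum ψ (n - j) := by
  rw [cumSum_eq_coeff_mul_mk_one, mul_assoc, coeff_mul, Nat.sum_antidiagonal_eq_sum_range_succ_mk]
  simp_rw [cumSum_eq_coeff_mul_mk_one]

lemma cumSum_nonneg {R : Type*} [Semiring R] [PartialOrder R] [IsOrderedRing R] {φ : R⟦X⟧}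
    (h : ∀ n, 0 ≤ coeff n φ) (n : ℕ) : 0 ≤ cumSum φ n :=
  sum_nonneg fun i _ => h i

lemma cumSum_mono {R : Type*} [Semiring R] [PartialOrder R] [IsOrderedRing R] {φ : R⟦X⟧}
    (h : ∀ n, 0 ≤ coeff n φ) : Monotone (cumSum φ) := fun _ _ hmn =>
  sum_le_sum_of_subset_of_nonneg (range_mono (Nat.succ_le_succ hmn)) fun _ _ _ => h _

lemma coeff_pow_nonneg {R : Type*} [Semiring R] [PartialOrder R] [IsOrderedRing R] {F : R⟦X⟧}
    (h : ∀ n, 0 ≤ coeff n F) (k n : ℕ) : 0 ≤ coeff n (F ^ k) := by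
  induction k generalizing n with
  | zero => rw [pow_zero, coeff_one]; split_ifs <;> simp
  | succ k ih =>
    rw [pow_succ, coeff_mul]
    exact sum_nonneg fun p _ => mul_nonneg (ih _) (h _)

lemma tailSum_succ_eq_cumSum {R : Type*} [Ring R] (F : R⟦X⟧) (n : ℕ) :
    tailSum F (n + 1) = cumSum ((1 - F) * PowerSeries.mk 1) n := by
  refine sum_congr rfl fun m _ => ?_
  rw [← cumSum_eq_coeff_mul_mk_one]
  simp [cumSum, coeff_one]

variable {K : Type*} [Field K] {F : K⟦X⟧}

lemma one_sub_mul_inv_one_sub (h0 : constantCoeff F = 0) : (1 - F) * (1 - F)⁻¹ = 1 :=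
  PowerSeries.mul_inv_cancel _ (by simp [h0])

lemma inv_one_sub_eq_one_add_renewalSeries (h0 : constantCoeff F = 0) :
    (1 - F)⁻¹ = 1 + renewalSeries F := by
  linear_combination (norm := (rw [renewalSeries]; ring)) one_sub_mul_inv_one_sub h0

lemma sum_Ico_coeff_pow_mul (h0 : constantCoeff F = 0) (φ : K⟦X⟧) {i m n : ℕ} (hi : i ≤ n)
    (hm : m < n) :
    ∑ k ∈ Ico i n, coeff m (F ^ k * φ) = coeff m (F ^ i * ((1 - F)⁻¹ * φ)) := by
  have hgeom : ∑ k ∈ Ico i n, F ^ k * φ =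
      F ^ i * ((1 - F)⁻¹ * φ) - F ^ n * ((1 - F)⁻¹ * φ) := by
    rw [← sum_mul]
    linear_combination (1 - F)⁻¹ * φ * geom_sum_Ico_mul_neg F hi
      - (∑ k ∈ Ico i n, F ^ k) * φ * one_sub_mul_inv_one_sub h0
  have hdvd : (X : K⟦X⟧) ^ n ∣ F ^ n * ((1 - F)⁻¹ * φ) :=
    (pow_dvd_pow_of_dvd (X_dvd_iff.2 h0) n).mul_right _
  rw [← map_sum, hgeom, map_sub, X_pow_dvd_iff.1 hdvd m hm, sub_zero]

lemma sum_Ico_cumSum_pow_mul (h0 : constantCoeff F = 0) (φ : K⟦X⟧) {i m n : ℕ} (hi : i ≤ n)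
    (hm : m < n) :
    ∑ k ∈ Ico i n, cumSum (F ^ k * φ) m = cumSum (F ^ i * ((1 - F)⁻¹ * φ)) m := by
  simp_rw [cumSum]
  rw [sum_comm]
  exact sum_congr rfl fun j hj =>
    sum_Ico_coeff_pow_mul h0 φ hi ((Nat.lt_succ_iff.1 (mem_range.1 hj)).trans_lt hm)

lemma sum_Icc_coeff_pow (h0 : constantCoeff F = 0) (n : ℕ) :
    ∑ k ∈ Icc 1 n, coeff n (F ^ k) = coeff n (renewalSeries F) := by
  simpa [renewalSeries, Ico_add_one_right_eq_Icc] using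
    sum_Ico_coeff_pow_mul h0 1 (Nat.le_add_left 1 n) (Nat.lt_succ_self n)

lemma sum_Icc_cumSum_pow (h0 : constantCoeff F = 0) (n : ℕ) :
    ∑ k ∈ Icc 1 n, cumSum (F ^ k) n = renewalFun F n := by
  simpa [renewalFun, renewalSeries, Ico_add_one_right_eq_Icc] using
    sum_Ico_cumSum_pow_mul h0 1 (Nat.le_add_left 1 n) (Nat.lt_succ_self n)

lemma sum_Icc_coeff_renewalSeries (h0 : constantCoeff F = 0) (n : ℕ) :
    ∑ k ∈ Icc 1 n, coeff k (renewalSeries F) = renewalFun F n := by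
  have hzero : coeff 0 (renewalSeries F) = 0 := by simp [renewalSeries, h0]
  rw [renewalFun, cumSum, range_eq_Ico, sum_eq_sum_Ico_succ_bot n.succ_pos, hzero, zero_add,
    zero_add, Nat.succ_eq_add_one, Ico_add_one_right_eq_Icc]

lemma cumSum_inv_one_sub (h0 : constantCoeff F = 0) (n : ℕ) :
    cumSum (1 - F)⁻¹ n = 1 + renewalFun F n := by
  rw [inv_one_sub_eq_one_add_renewalSeries h0]
  simp [renewalFun, cumSum, sum_add_distrib, coeff_one]

lemma sum_Icc_mul_cumSum_pow (h0 : constantCoeff F = 0) (n : ℕ) :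
    ∑ k ∈ Icc 1 n, (k : K) * cumSum (F ^ k) n = cumSum (renewalSeries F * (1 - F)⁻¹) n := by
  calc ∑ k ∈ Icc 1 n, (k : K) * cumSum (F ^ k) n
      = ∑ k ∈ Icc 1 n, ∑ _i ∈ Icc 1 k, cumSum (F ^ k) n := by simp
    _ = ∑ i ∈ Icc 1 n, ∑ k ∈ Icc i n, cumSum (F ^ k) n :=
        sum_comm' fun k i => by simp only [mem_Icc]; omega
    _ = ∑ i ∈ Icc 1 n, cumSum (F ^ i * (1 - F)⁻¹) n := by
        refine sum_congr rfl fun i hi => ?_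
        simpa [Ico_add_one_right_eq_Icc] using
          sum_Ico_cumSum_pow_mul h0 1 ((mem_Icc.1 hi).2.trans n.le_succ) n.lt_succ_self
    _ = cumSum (renewalSeries F * (1 - F)⁻¹) n := by
        simpa [renewalSeries, mul_assoc, Ico_add_one_right_eq_Icc] using
          sum_Ico_cumSum_pow_mul h0 (1 - F)⁻¹ (Nat.le_add_left 1 n) n.lt_succ_self

-- The renewal equation `(1 - F)⁻¹ * (1 - F) = 1`, summed twice.
lemma sum_coeff_inv_one_sub_mul_tailSum (h0 : constantCoeff F = 0) (n : ℕ) :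
    ∑ j ∈ range (n + 1), coeff j (1 - F)⁻¹ * tailSum F (n - j + 1) = n + 1 := by
  have hcancel : (1 - F)⁻¹ * ((1 - F) * PowerSeries.mk 1) = PowerSeries.mk 1 := by
    rw [← mul_assoc, mul_comm _ (1 - F), one_sub_mul_inv_one_sub h0, one_mul]
  simp_rw [tailSum_succ_eq_cumSum]
  rw [← cumSum_mul, hcancel]
  simp [cumSum]

lemma sum_coeff_renewalSeries_mul_sub (F : K⟦X⟧) (n : ℕ) :
    ∑ j ∈ range (n + 1), coeff j (renewalSeries F) * ((n : K) - j) =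
      ∑ i ∈ range n, renewalFun F i := by
  induction n with
  | zero => simp
  | succ n ih =>
    rw [sum_range_succ, sum_range_succ (renewalFun F), ← ih, renewalFun, cumSum, ← sum_add_distrib,
      sub_self, mul_zero, add_zero]
    refine sum_congr rfl fun j _ => ?_
    push_cast; ring

end GeneratingSeries

/-- `F` is the generating series of a law on `{1, 2, …}` of total mass at most `1`: the law of a
lifetime, which may be defective. -/
structure IsLifetimeSeries (F : ℝ⟦X⟧) : Prop where
  constantCoeff_eq_zero : constantCoeff F = 0
  coeff_nonneg : ∀ n, 0 ≤ coeff n F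
  cumSum_le_one : ∀ n, cumSum F n ≤ 1

namespace IsLifetimeSeries

variable {F : ℝ⟦X⟧}

lemma cumSum_pow_nonneg (hF : IsLifetimeSeries F) (k n : ℕ) : 0 ≤ cumSum (F ^ k) n :=
  cumSum_nonneg (coeff_pow_nonneg hF.coeff_nonneg k) n

lemma cumSum_pow_le_one (hF : IsLifetimeSeries F) (k n : ℕ) : cumSum (F ^ k) n ≤ 1 := by
  induction k generalizing n with
  | zero => simp [cumSum, coeff_one]
  | succ k ih =>
    calc cumSum (F ^ (k + 1)) n
        = ∑ j ∈ range (n + 1), coeff j F * cumSum (F ^ k) (n - j) := by rw [pow_succ', cumSum_mul]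
      _ ≤ ∑ j ∈ range (n + 1), coeff j F :=
          sum_le_sum fun j _ => mul_le_of_le_one_right (hF.coeff_nonneg j) (ih _)
      _ ≤ 1 := hF.cumSum_le_one n

lemma coeff_renewalSeries_nonneg (hF : IsLifetimeSeries F) (n : ℕ) :
    0 ≤ coeff n (renewalSeries F) := by
  rw [← sum_Icc_coeff_pow hF.constantCoeff_eq_zero]
  exact sum_nonneg fun _ _ => coeff_pow_nonneg hF.coeff_nonneg _ _

lemma coeff_inv_one_sub_nonneg (hF : IsLifetimeSeries F) (n : ℕ) : 0 ≤ coeff n (1 - F)⁻¹ := by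
  rw [inv_one_sub_eq_one_add_renewalSeries hF.constantCoeff_eq_zero, map_add, coeff_one]
  exact add_nonneg (by split_ifs <;> simp) (hF.coeff_renewalSeries_nonneg n)

lemma renewalFun_nonneg (hF : IsLifetimeSeries F) (n : ℕ) : 0 ≤ renewalFun F n :=
  cumSum_nonneg hF.coeff_renewalSeries_nonneg n

lemma renewalFun_mono (hF : IsLifetimeSeries F) : Monotone (renewalFun F) :=
  cumSum_mono hF.coeff_renewalSeries_nonneg

lemma renewalFun_le (hF : IsLifetimeSeries F) (n : ℕ) : renewalFun F n ≤ n := by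
  rw [← sum_Icc_cumSum_pow hF.constantCoeff_eq_zero]
  calc ∑ k ∈ Icc 1 n, cumSum (F ^ k) n ≤ ∑ _k ∈ Icc 1 n, (1 : ℝ) :=
        sum_le_sum fun _ _ => hF.cumSum_pow_le_one _ n
    _ = n := by simp

lemma tailSum_mono (hF : IsLifetimeSeries F) : Monotone (tailSum F) := fun _ _ hmn =>
  sum_le_sum_of_subset_of_nonneg (range_mono hmn) fun i _ _ => sub_nonneg.2 (hF.cumSum_le_one i)

lemma tailSum_nonneg (hF : IsLifetimeSeries F) (n : ℕ) : 0 ≤ tailSum F n :=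
  sum_nonneg fun i _ => sub_nonneg.2 (hF.cumSum_le_one i)

lemma tailSum_pos (hF : IsLifetimeSeries F) {n : ℕ} (hn : 0 < n) : 0 < tailSum F n := by
  have hone : tailSum F 1 = 1 := by simp [tailSum, cumSum, hF.constantCoeff_eq_zero]
  exact (hone ▸ zero_lt_one).trans_le (hF.tailSum_mono hn)

lemma tailSum_le (hF : IsLifetimeSeries F) (n : ℕ) : tailSum F n ≤ n := by
  calc tailSum F n ≤ ∑ _m ∈ range n, (1 : ℝ) :=
        sum_le_sum fun _ _ => sub_le_self 1 (cumSum_nonneg hF.coeff_nonneg _)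
    _ = n := by simp

lemma le_one_add_renewalFun_mul_tailSum (hF : IsLifetimeSeries F) (n : ℕ) :
    (n : ℝ) ≤ (1 + renewalFun F n) * tailSum F n := by
  cases n with
  | zero => simp [tailSum]
  | succ n =>
    calc ((n + 1 : ℕ) : ℝ) = ∑ j ∈ range (n + 1), coeff j (1 - F)⁻¹ * tailSum F (n - j + 1) := by
          rw [sum_coeff_inv_one_sub_mul_tailSum hF.constantCoeff_eq_zero]; push_cast; rfl
      _ ≤ ∑ j ∈ range (n + 1), coeff j (1 - F)⁻¹ * tailSum F (n + 1) :=
          sum_le_sum fun j _ => mul_le_mul_of_nonneg_left (hF.tailSum_mono (by omega))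
            (hF.coeff_inv_one_sub_nonneg j)
      _ = (1 + renewalFun F n) * tailSum F (n + 1) := by
          rw [← sum_mul, ← cumSum_inv_one_sub hF.constantCoeff_eq_zero, cumSum]
      _ ≤ (1 + renewalFun F (n + 1)) * tailSum F (n + 1) := by
          have := hF.renewalFun_mono n.le_succ
          have := hF.tailSum_nonneg (n + 1)
          gcongr

lemma one_add_renewalFun_mul_tailSum_le (hF : IsLifetimeSeries F) (n m : ℕ) :
    (1 + renewalFun F n) * tailSum F m ≤ n + m := by
  cases m with
  | zero => simp [tailSum]
  | succ m =>
    calc (1 + renewalFun F n) * tailSum F (m + 1)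
        = ∑ j ∈ range (n + 1), coeff j (1 - F)⁻¹ * tailSum F (m + 1) := by
          rw [← sum_mul, ← cumSum_inv_one_sub hF.constantCoeff_eq_zero, cumSum]
      _ ≤ ∑ j ∈ range (n + 1), coeff j (1 - F)⁻¹ * tailSum F (n + m - j + 1) := by
          refine sum_le_sum fun j hj => mul_le_mul_of_nonneg_left (hF.tailSum_mono ?_)
            (hF.coeff_inv_one_sub_nonneg j)
          have := mem_range.1 hj
          omega
      _ ≤ ∑ j ∈ range (n + m + 1), coeff j (1 - F)⁻¹ * tailSum F (n + m - j + 1) :=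
          sum_le_sum_of_subset_of_nonneg (range_mono (by omega)) fun j _ _ =>
            mul_nonneg (hF.coeff_inv_one_sub_nonneg j) (hF.tailSum_nonneg _)
      _ = n + (m + 1 : ℕ) := by
          rw [sum_coeff_inv_one_sub_mul_tailSum hF.constantCoeff_eq_zero]; push_cast; ring

lemma sum_range_renewalFun_mul_tailSum_le (hF : IsLifetimeSeries F) (n m : ℕ) :
    (∑ i ∈ range n, renewalFun F i) * tailSum F m ≤ (n : ℝ) ^ 2 / 2 + n * m := by
  induction n with
  | zero => simp
  | succ n ih =>
    have := hF.one_add_renewalFun_mul_tailSum_le n m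
    have := hF.tailSum_nonneg m
    rw [sum_range_succ]
    push_cast
    linarith

lemma sum_Icc_mul_cumSum_pow_mul_tailSum_le (hF : IsLifetimeSeries F) (n m : ℕ) :
    (∑ k ∈ Icc 1 n, (k : ℝ) * cumSum (F ^ k) n) * tailSum F m ≤
      (∑ i ∈ range n, renewalFun F i) + m * renewalFun F n := by
  calc (∑ k ∈ Icc 1 n, (k : ℝ) * cumSum (F ^ k) n) * tailSum F m
      = ∑ j ∈ range (n + 1),
          coeff j (renewalSeries F) * ((1 + renewalFun F (n - j)) * tailSum F m) := by
        simp_rw [sum_Icc_mul_cumSum_pow hF.constantCoeff_eq_zero, cumSum_mul, sum_mul,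
          cumSum_inv_one_sub hF.constantCoeff_eq_zero, mul_assoc]
    _ ≤ ∑ j ∈ range (n + 1), coeff j (renewalSeries F) * ((n : ℝ) - j + m) := by
        refine sum_le_sum fun j hj => mul_le_mul_of_nonneg_left ?_ (hF.coeff_renewalSeries_nonneg j)
        rw [← Nat.cast_sub (Nat.lt_succ_iff.1 (mem_range.1 hj))]
        exact hF.one_add_renewalFun_mul_tailSum_le _ _
    _ = (∑ i ∈ range n, renewalFun F i) + m * renewalFun F n := by
        simp_rw [mul_add, sum_add_distrib, sum_coeff_renewalSeries_mul_sub, ← sum_mul]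
        rw [renewalFun, cumSum, mul_comm (m : ℝ)]

lemma sum_Icc_mul_cumSum_pow_mul_tailSum_sq_le (hF : IsLifetimeSeries F) (n m : ℕ) :
    (∑ k ∈ Icc 1 n, (k : ℝ) * cumSum (F ^ k) n) * tailSum F m ^ 2 ≤
      (n : ℝ) ^ 2 / 2 + 2 * n * m + (m : ℝ) ^ 2 := by
  have hL := hF.tailSum_nonneg m
  have hfirst := mul_le_mul_of_nonneg_right (hF.sum_Icc_mul_cumSum_pow_mul_tailSum_le n m) hL
  have hsum := hF.sum_range_renewalFun_mul_tailSum_le n m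
  have hlast : m * (renewalFun F n * tailSum F m) ≤ (m : ℝ) * (n + m) := by
    gcongr
    linarith [hF.one_add_renewalFun_mul_tailSum_le n m]
  linarith

end IsLifetimeSeries

section SlowVariation

/-- A sequence `L` is slowly varying (Bojanic–Seneta): `L ⌊c n⌋ / L n → 1` for every `c > 0`. -/
def SlowlyVaryingSeq (L : ℕ → ℝ) : Prop :=
  ∀ c : ℝ, 0 < c → Tendsto (fun n : ℕ => L ⌊c * n⌋₊ / L n) atTop (𝓝 1)

lemma tendsto_floor_mul_natCast_atTop {c : ℝ} (hc : 0 < c) :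
    Tendsto (fun n : ℕ => ⌊c * n⌋₊) atTop atTop :=
  tendsto_nat_floor_atTop.comp (tendsto_natCast_atTop_atTop.const_mul_atTop hc)

lemma floor_mul_natCast_le {c : ℝ} (hc : c ≤ 1) (n : ℕ) : ⌊c * n⌋₊ ≤ n :=
  Nat.floor_le_of_le (mul_le_of_le_one_left n.cast_nonneg hc)

lemma SlowlyVaryingSeq.tendsto_div_floor {L : ℕ → ℝ} (hL : SlowlyVaryingSeq L) {c : ℝ}
    (hc : 0 < c) : Tendsto (fun n : ℕ => L n / L ⌊c * n⌋₊) atTop (𝓝 1) := by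
  simpa using (hL c hc).inv₀ one_ne_zero

lemma slowlyVaryingSeq_of_isSlowlyVarying {ℓ : ℝ → ℝ} (hmono : Monotone ℓ)
    (hℓ : IsSlowlyVarying ℓ) : SlowlyVaryingSeq fun n => ℓ n := by
  obtain ⟨⟨A, -, hA⟩, hlim⟩ := hℓ
  have hpos : ∀ᶠ n : ℕ in atTop, 0 < ℓ n :=
    tendsto_natCast_atTop_atTop.eventually ((eventually_ge_atTop A).mono hA)
  intro c hc
  have hhalf := (hlim (c / 2) (half_pos hc)).comp tendsto_natCast_atTop_atTop
  have hfull := (hlim c hc).comp tendsto_natCast_atTop_atTop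
  refine tendsto_of_tendsto_of_tendsto_of_le_of_le' hhalf hfull ?_ ?_
  · filter_upwards [hpos, (tendsto_natCast_atTop_atTop.const_mul_atTop (half_pos hc)).eventually
      (eventually_ge_atTop (1 : ℝ))] with n hn hlarge
    exact div_le_div_of_nonneg_right
      (hmono (by linarith [Nat.lt_floor_add_one (c * n)])) hn.le
  · filter_upwards [hpos] with n hn
    exact div_le_div_of_nonneg_right (hmono (Nat.floor_le (by positivity))) hn.le

lemma tendsto_zero_of_contraction {x e : ℕ → ℝ} {φ : ℕ → ℕ} {ρ C : ℝ} (hx0 : ∀ n, 0 ≤ x n)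
    (hxC : ∀ n, x n ≤ C) (hφ : Tendsto φ atTop atTop) (hρ0 : 0 ≤ ρ) (hρ1 : ρ < 1)
    (he : Tendsto e atTop (𝓝 0)) (hx : ∀ᶠ n in atTop, x n ≤ ρ * x (φ n) + e n) :
    Tendsto x atTop (𝓝 0) := by
  have hiter : ∀ j : ℕ, ∀ ε > 0, ∀ᶠ n in atTop, x n < ρ ^ j * C + ε := by
    intro j
    induction j with
    | zero => exact fun ε hε => Eventually.of_forall fun n => by linarith [hxC n, pow_zero ρ]
    | succ j ih =>
      intro ε hε
      filter_upwards [hx, hφ.eventually (ih (ε / 2) (half_pos hε)),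
        he.eventually_lt_const (half_pos hε)] with n hstep hprev herr
      have := mul_le_mul_of_nonneg_left hprev.le hρ0
      rw [pow_succ]
      nlinarith
  refine tendsto_order.2 ⟨fun b hb => Eventually.of_forall fun n => hb.trans_le (hx0 n),
    fun b hb => ?_⟩
  have hpow : Tendsto (fun j : ℕ => ρ ^ j * C) atTop (𝓝 0) := by
    simpa using (tendsto_pow_atTop_nhds_zero_of_lt_one hρ0 hρ1).mul_const C
  obtain ⟨j, hj⟩ := (hpow.eventually_lt_const (half_pos hb)).exists
  filter_upwards [hiter j (b / 2) (half_pos hb)] with n hn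
  linarith

lemma tendsto_of_forall_eventually_le_mul {x : ℕ → ℝ} {y : ℝ → ℕ → ℝ} {φ : ℝ → ℝ} {l : ℝ}
    (hlow : ∀ᶠ n in atTop, l ≤ x n) (hφ : Tendsto φ (𝓝[>] 0) (𝓝 l))
    (hy : ∀ ε > 0, Tendsto (y ε) atTop (𝓝 1))
    (hup : ∀ ε > 0, ∀ᶠ n in atTop, x n ≤ φ ε * y ε n) :
    Tendsto x atTop (𝓝 l) := by
  refine tendsto_order.2 ⟨fun b hb => hlow.mono fun n hn => hb.trans_le hn, fun b hb => ?_⟩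
  obtain ⟨ε, hφε, hε⟩ := ((hφ.eventually_lt_const hb).and self_mem_nhdsWithin).exists
  have hlim : Tendsto (fun n => φ ε * y ε n) atTop (𝓝 (φ ε)) := by
    simpa using (hy ε hε).const_mul (φ ε)
  filter_upwards [hup ε hε, hlim.eventually_lt_const hφε] with n h₁ h₂
  exact h₁.trans_lt h₂

end SlowVariation

section RenewalAsymptotics

variable {F : ℝ⟦X⟧}

lemma tendsto_tailSum_div (hF : IsLifetimeSeries F) (hL : SlowlyVaryingSeq (tailSum F)) :
    Tendsto (fun n : ℕ => tailSum F n / n) atTop (𝓝 0) := by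
  have hfloor := tendsto_floor_mul_natCast_atTop (one_half_pos (α := ℝ))
  refine tendsto_zero_of_contraction (C := 1) (ρ := 3 / 4) (φ := fun n : ℕ => ⌊(1 / 2 : ℝ) * n⌋₊)
    (e := 0) (fun n => div_nonneg (hF.tailSum_nonneg n) n.cast_nonneg)
    (fun n => div_le_one_of_le₀ (hF.tailSum_le n) n.cast_nonneg)
    hfloor (by norm_num) (by norm_num) tendsto_const_nhds ?_
  filter_upwards [(hL.tendsto_div_floor (one_half_pos (α := ℝ))).eventually_lt_const
    (by norm_num : (1 : ℝ) < 3 / 2), eventually_gt_atTop 0,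
    hfloor.eventually (eventually_gt_atTop 0)] with n hratio hn hm
  have hmn : (⌊(1 / 2 : ℝ) * n⌋₊ : ℝ) ≤ 1 / 2 * n := Nat.floor_le (by positivity)
  set m := ⌊(1 / 2 : ℝ) * n⌋₊
  have hLm : 0 < tailSum F m := hF.tailSum_pos hm
  rw [div_lt_iff₀ hLm] at hratio
  have : (0 : ℝ) < n := Nat.cast_pos.2 hn
  have : (0 : ℝ) < m := Nat.cast_pos.2 hm
  calc tailSum F n / n ≤ 3 / 2 * tailSum F m / n := by gcongr
    _ ≤ 3 / 2 * tailSum F m / (2 * m) := by gcongr; linarith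
    _ = 3 / 4 * (tailSum F m / m) + (0 : ℕ → ℝ) n := by rw [Pi.zero_apply]; ring

lemma tendsto_one_add_renewalFun_mul_tailSum_div (hF : IsLifetimeSeries F)
    (hL : SlowlyVaryingSeq (tailSum F)) :
    Tendsto (fun n : ℕ => (1 + renewalFun F n) * tailSum F n / n) atTop (𝓝 1) := by
  refine tendsto_of_forall_eventually_le_mul (φ := fun ε => 1 + ε)
    (y := fun ε n => tailSum F n / tailSum F ⌊ε * n⌋₊) ?_ ?_
    (fun ε hε => hL.tendsto_div_floor hε) fun ε hε => ?_
  · filter_upwards [eventually_gt_atTop 0] with n hn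
    rw [one_le_div (Nat.cast_pos.2 hn)]
    exact hF.le_one_add_renewalFun_mul_tailSum n
  · simpa using ((continuous_const_add (1 : ℝ)).tendsto 0).mono_left nhdsWithin_le_nhds
  · filter_upwards [eventually_gt_atTop 0,
      (tendsto_floor_mul_natCast_atTop hε).eventually (eventually_gt_atTop 0)] with n hn hm
    have hup := hF.one_add_renewalFun_mul_tailSum_le n ⌊ε * n⌋₊
    have hfloor : (⌊ε * n⌋₊ : ℝ) ≤ ε * n := Nat.floor_le (by positivity)
    have hLm := hF.tailSum_pos hm
    have hLn := hF.tailSum_nonneg n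
    have : (0 : ℝ) < n := Nat.cast_pos.2 hn
    calc (1 + renewalFun F n) * tailSum F n / n
        ≤ (n + ⌊ε * n⌋₊) / tailSum F ⌊ε * n⌋₊ * tailSum F n / n := by
          gcongr
          rwa [le_div_iff₀ hLm]
      _ ≤ ((1 + ε) * n) / tailSum F ⌊ε * n⌋₊ * tailSum F n / n := by
          gcongr
          linarith
      _ = (1 + ε) * (tailSum F n / tailSum F ⌊ε * n⌋₊) := by field_simp

lemma tendsto_renewalFun_mul_tailSum_div (hF : IsLifetimeSeries F)
    (hL : SlowlyVaryingSeq (tailSum F)) :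
    Tendsto (fun n : ℕ => renewalFun F n * tailSum F n / n) atTop (𝓝 1) := by
  have h := (tendsto_one_add_renewalFun_mul_tailSum_div hF hL).sub (tendsto_tailSum_div hF hL)
  rw [sub_zero] at h
  exact h.congr fun n => by ring

lemma isEquivalent_renewalFun (hF : IsLifetimeSeries F) (hL : SlowlyVaryingSeq (tailSum F)) :
    renewalFun F ~[atTop] fun n : ℕ => (n : ℝ) / tailSum F n := by
  refine (isEquivalent_iff_tendsto_one ?_).2
    ((tendsto_renewalFun_mul_tailSum_div hF hL).congr fun n => by simp [div_div_eq_mul_div])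
  filter_upwards [eventually_gt_atTop 0] with n hn
  exact (div_pos (Nat.cast_pos.2 hn) (hF.tailSum_pos hn)).ne'

lemma eventually_renewalFun_pos (hF : IsLifetimeSeries F) (hL : SlowlyVaryingSeq (tailSum F)) :
    ∀ᶠ n in atTop, 0 < renewalFun F n := by
  filter_upwards [(tendsto_renewalFun_mul_tailSum_div hF hL).eventually_const_lt zero_lt_one]
    with n hn
  refine (hF.renewalFun_nonneg n).lt_of_ne fun hzero => ?_
  simp [← hzero] at hn

lemma tendsto_renewalFun_floor_div (hF : IsLifetimeSeries F) (hL : SlowlyVaryingSeq (tailSum F))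
    {ρ : ℝ} (hρ : 0 < ρ) :
    Tendsto (fun n : ℕ => renewalFun F ⌊ρ * n⌋₊ / renewalFun F n) atTop (𝓝 ρ) := by
  have ha := tendsto_renewalFun_mul_tailSum_div hF hL
  have hfloor := tendsto_floor_mul_natCast_atTop hρ
  have hindex : Tendsto (fun n : ℕ => (⌊ρ * n⌋₊ : ℝ) / n) atTop (𝓝 ρ) :=
    (tendsto_nat_floor_mul_div_atTop hρ.le).comp tendsto_natCast_atTop_atTop
  have hprod := (((ha.comp hfloor).mul (ha.inv₀ one_ne_zero)).mul hindex).mul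
    (hL.tendsto_div_floor hρ)
  rw [inv_one, mul_one, mul_one, one_mul] at hprod
  refine hprod.congr' ?_
  filter_upwards [eventually_gt_atTop 0, hfloor.eventually (eventually_gt_atTop 0),
    eventually_renewalFun_pos hF hL] with n hn hm han
  have hLn := hF.tailSum_pos hn
  have hLm := hF.tailSum_pos hm
  have : (0 : ℝ) < n := Nat.cast_pos.2 hn
  have : (0 : ℝ) < ⌊ρ * n⌋₊ := Nat.cast_pos.2 hm
  simp only [Function.comp_apply]
  field_simp

end RenewalAsymptotics

section Concentration

lemma sum_Icc_max_sub_le {A : ℝ} (hA : 0 ≤ A) (N : ℕ) :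
    ∑ k ∈ Icc 1 N, max (A - k) 0 ≤ A ^ 2 / 2 := by
  suffices h : ∑ k ∈ Icc 1 N, max (A - k) 0 ≤ A ^ 2 / 2 - max (A - N) 0 ^ 2 / 2 from
    h.trans (sub_le_self _ (by positivity))
  induction N with
  | zero => simp [hA]
  | succ N ih =>
    rw [sum_Icc_succ_top (Nat.le_add_left 1 N)]
    push_cast
    rcases le_total (A - (N + 1)) 0 with h | h
    · rw [max_eq_right h]
      nlinarith [sq_nonneg (max (A - N) 0)]
    · rw [max_eq_left (by linarith : 0 ≤ A - N)] at ih
      rw [max_eq_left h]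
      nlinarith

-- Bathtub principle: weights in `[0, 1]` of total mass `A` have first moment about `A ^ 2 / 2` at
-- least, with near equality only if they are close to the indicator function of `[0, A]`.
lemma sum_le_sum_mul_sub_sq_half {p w : ℕ → ℝ} {N : ℕ} {A : ℝ} {T : Finset ℕ}
    (hp0 : ∀ k, 0 ≤ p k) (hp1 : ∀ k, p k ≤ 1) (hA : ∑ k ∈ Icc 1 N, p k = A) (hT : T ⊆ Icc 1 N)
    (hw : ∀ k ∈ T, w k ≤ (k - A) * p k + max (A - k) 0) :
    ∑ k ∈ T, w k ≤ ∑ k ∈ Icc 1 N, (k : ℝ) * p k - A ^ 2 / 2 := by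
  have hA0 : 0 ≤ A := hA ▸ sum_nonneg fun k _ => hp0 k
  have hterm : ∀ k : ℕ, 0 ≤ (k - A) * p k + max (A - k) 0 := fun k => by
    rcases le_total (k : ℝ) A with h | h
    · rw [max_eq_left (sub_nonneg.2 h)]
      nlinarith [hp1 k]
    · exact add_nonneg (mul_nonneg (sub_nonneg.2 h) (hp0 k)) (le_max_right _ _)
  calc ∑ k ∈ T, w k ≤ ∑ k ∈ T, ((k - A) * p k + max (A - k) 0) := sum_le_sum hw
    _ ≤ ∑ k ∈ Icc 1 N, ((k - A) * p k + max (A - k) 0) :=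
        sum_le_sum_of_subset_of_nonneg hT fun k _ _ => hterm k
    _ = ∑ k ∈ Icc 1 N, (k : ℝ) * p k - A ^ 2 + ∑ k ∈ Icc 1 N, max (A - k) 0 := by
        simp_rw [sub_mul, sum_add_distrib, sum_sub_distrib, ← mul_sum, hA, sq]
    _ ≤ ∑ k ∈ Icc 1 N, (k : ℝ) * p k - A ^ 2 / 2 := by
        linarith [sum_Icc_max_sub_le hA0 N]

/-- The excess of `∑ k * P (s_k ≤ n)` over half the square of `∑ P (s_k ≤ n) = a(n)`, its
approximate minimum. It measures how far `k ↦ P (s_k ≤ n)` is from a sharp cutoff at `a(n)`. -/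
noncomputable def momentGap (F : ℝ⟦X⟧) (n : ℕ) : ℝ :=
  ∑ k ∈ Icc 1 n, (k : ℝ) * cumSum (F ^ k) n - renewalFun F n ^ 2 / 2

/-- The numbers of renewals falling short of `a(n)` by the proportion `η` or more. -/
noncomputable def lowCounts (F : ℝ⟦X⟧) (η : ℝ) (n : ℕ) : Finset ℕ :=
  {k ∈ Icc 1 n | (k : ℝ) ≤ (1 - η) * renewalFun F n}

/-- The numbers of renewals exceeding `a(n)` by more than the proportion `η`. -/
noncomputable def highCounts (F : ℝ⟦X⟧) (η : ℝ) (n : ℕ) : Finset ℕ :=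
  {k ∈ Icc 1 n | (1 + η) * renewalFun F n < k}

/-- The numbers of renewals that are not within relative distance `δ` of `a(n)`. -/
noncomputable def deviantCounts (F : ℝ⟦X⟧) (δ : ℝ) (n : ℕ) : Finset ℕ :=
  {k ∈ Icc 1 n | δ * renewalFun F n ≤ |(k : ℝ) - renewalFun F n|}

/-- The part of the renewal probability `u(n)` contributed by deviant numbers of renewals. -/
noncomputable def deviantMass (F : ℝ⟦X⟧) (δ : ℝ) (n : ℕ) : ℝ :=
  ∑ k ∈ deviantCounts F δ n, coeff n (F ^ k)

variable {F : ℝ⟦X⟧}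

lemma sum_le_momentGap (hF : IsLifetimeSeries F) {n : ℕ} {T : Finset ℕ} {w : ℕ → ℝ}
    (hT : T ⊆ Icc 1 n)
    (hw : ∀ k ∈ T, w k ≤
      (k - renewalFun F n) * cumSum (F ^ k) n + max (renewalFun F n - k) 0) :
    ∑ k ∈ T, w k ≤ momentGap F n :=
  sum_le_sum_mul_sub_sq_half (fun k => hF.cumSum_pow_nonneg k n) (fun k => hF.cumSum_pow_le_one k n)
    (sum_Icc_cumSum_pow hF.constantCoeff_eq_zero n) hT hw

lemma momentGap_nonneg (hF : IsLifetimeSeries F) (n : ℕ) : 0 ≤ momentGap F n := by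
  simpa using sum_le_momentGap hF (w := 0) (empty_subset (Icc 1 n)) (by simp)

lemma sum_lowCounts_mul_le_momentGap (hF : IsLifetimeSeries F) (η : ℝ) (n : ℕ) :
    (∑ k ∈ lowCounts F η n, (1 - cumSum (F ^ k) n)) * (η * renewalFun F n) ≤ momentGap F n := by
  rw [sum_mul]
  refine sum_le_momentGap hF (filter_subset _ _) fun k hk => ?_
  have hlow := (mem_filter.1 hk).2
  have hmax := le_max_left (renewalFun F n - k) 0
  nlinarith [hF.cumSum_pow_le_one k n]

lemma sum_highCounts_mul_le_momentGap (hF : IsLifetimeSeries F) (η : ℝ) (n : ℕ) :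
    (∑ k ∈ highCounts F η n, cumSum (F ^ k) n) * (η * renewalFun F n) ≤ momentGap F n := by
  rw [sum_mul]
  refine sum_le_momentGap hF (filter_subset _ _) fun k hk => ?_
  have hhigh := (mem_filter.1 hk).2
  have hmax := le_max_right (renewalFun F n - k) 0
  nlinarith [hF.cumSum_pow_nonneg k n]

lemma tendsto_sum_Icc_mul_cumSum_pow_div (hF : IsLifetimeSeries F)
    (hL : SlowlyVaryingSeq (tailSum F)) :
    Tendsto (fun n : ℕ => (∑ k ∈ Icc 1 n, (k : ℝ) * cumSum (F ^ k) n) / renewalFun F n ^ 2) atTop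
      (𝓝 (1 / 2)) := by
  have ha := (tendsto_renewalFun_mul_tailSum_div hF hL).inv₀ one_ne_zero
  refine tendsto_of_forall_eventually_le_mul (φ := fun ε => 1 / 2 + 2 * ε + ε ^ 2)
    (y := fun ε n => ((renewalFun F n * tailSum F n / n)⁻¹ *
      (tailSum F n / tailSum F ⌊ε * n⌋₊)) ^ 2) ?_ ?_
    (fun ε hε => by simpa using (ha.mul (hL.tendsto_div_floor hε)).pow 2) fun ε hε => ?_
  · filter_upwards [eventually_renewalFun_pos hF hL] with n han
    rw [le_div_iff₀ (by positivity)]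
    have hgap := momentGap_nonneg hF n
    rw [momentGap] at hgap
    linarith
  · have hcont : Continuous fun ε : ℝ => 1 / 2 + 2 * ε + ε ^ 2 := by fun_prop
    simpa using (hcont.tendsto 0).mono_left nhdsWithin_le_nhds
  · filter_upwards [eventually_gt_atTop 0, eventually_renewalFun_pos hF hL,
      (tendsto_floor_mul_natCast_atTop hε).eventually (eventually_gt_atTop 0)] with n hn han hm
    have hfloor : (⌊ε * n⌋₊ : ℝ) ≤ ε * n := Nat.floor_le (by positivity)
    have hmoment := hF.sum_Icc_mul_cumSum_pow_mul_tailSum_sq_le n ⌊ε * n⌋₊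
    have hLn := hF.tailSum_pos hn
    have hLm := hF.tailSum_pos hm
    rw [← le_div_iff₀ (by positivity)] at hmoment
    have : (0 : ℝ) < n := Nat.cast_pos.2 hn
    calc (∑ k ∈ Icc 1 n, (k : ℝ) * cumSum (F ^ k) n) / renewalFun F n ^ 2
        ≤ ((n : ℝ) ^ 2 / 2 + 2 * n * (ε * n) + (ε * n) ^ 2) / tailSum F ⌊ε * n⌋₊ ^ 2 /
            renewalFun F n ^ 2 := by
          gcongr
          exact hmoment.trans (by gcongr)
      _ = _ := by field_simp

lemma tendsto_momentGap_div (hF : IsLifetimeSeries F) (hL : SlowlyVaryingSeq (tailSum F)) :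
    Tendsto (fun n => momentGap F n / renewalFun F n ^ 2) atTop (𝓝 0) := by
  have h := (tendsto_sum_Icc_mul_cumSum_pow_div hF hL).sub_const (1 / 2)
  rw [sub_self] at h
  refine h.congr' ?_
  filter_upwards [eventually_renewalFun_pos hF hL] with n han
  rw [momentGap]
  field_simp

lemma deviantMass_nonneg (hF : IsLifetimeSeries F) (δ : ℝ) (n : ℕ) : 0 ≤ deviantMass F δ n :=
  sum_nonneg fun k _ => coeff_pow_nonneg hF.coeff_nonneg k n

lemma sum_deviantMass_le_renewalFun (hF : IsLifetimeSeries F) (δ : ℝ) (N : ℕ) :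
    ∑ n ∈ Icc 1 N, deviantMass F δ n ≤ renewalFun F N := by
  rw [← sum_Icc_coeff_renewalSeries hF.constantCoeff_eq_zero]
  refine sum_le_sum fun n _ => ?_
  rw [← sum_Icc_coeff_pow hF.constantCoeff_eq_zero]
  exact sum_le_sum_of_subset_of_nonneg (filter_subset _ _)
    fun k _ _ => coeff_pow_nonneg hF.coeff_nonneg k n

lemma deviantCounts_subset (hF : IsLifetimeSeries F) {δ : ℝ} (hδ0 : 0 < δ) (hδ1 : δ < 1 / 2)
    {M n N : ℕ} (hMn : M ≤ n) (hnN : n ≤ N) (hN : 0 < renewalFun F N)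
    (hratio : (1 - δ / 2) * renewalFun F N ≤ renewalFun F M) :
    deviantCounts F δ n ⊆ lowCounts F (δ / 4) M ∪ highCounts F (δ / 4) N := by
  intro k hk
  have hlower := hF.renewalFun_mono hMn
  have hupper := hF.renewalFun_mono hnN
  rw [deviantCounts, mem_filter, mem_Icc, le_abs] at hk
  obtain ⟨⟨hk1, hkn⟩, hhigh | hlow⟩ := hk
  · refine mem_union_right _ (mem_filter.2 ⟨mem_Icc.2 ⟨hk1, hkn.trans hnN⟩, ?_⟩)
    calc (1 + δ / 4) * renewalFun F N < (1 + δ) * (1 - δ / 2) * renewalFun F N := by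
          gcongr; nlinarith
      _ = (1 + δ) * ((1 - δ / 2) * renewalFun F N) := by ring
      _ ≤ (1 + δ) * renewalFun F n := by gcongr; linarith
      _ ≤ k := by linarith
  · have hkM : (k : ℝ) ≤ (1 - δ / 4) * renewalFun F M := by
      calc (k : ℝ) ≤ (1 - δ) * renewalFun F n := by linarith
        _ ≤ (1 - δ) * renewalFun F N := by gcongr; linarith
        _ ≤ (1 - δ / 4) * (1 - δ / 2) * renewalFun F N := by gcongr; nlinarith
        _ = (1 - δ / 4) * ((1 - δ / 2) * renewalFun F N) := by ring
        _ ≤ (1 - δ / 4) * renewalFun F M := by gcongr; linarith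
    have hkM' : (k : ℝ) ≤ M := by
      nlinarith [hF.renewalFun_le M, hF.renewalFun_nonneg M]
    exact mem_union_left _ (mem_filter.2 ⟨mem_Icc.2 ⟨hk1, Nat.cast_le.1 hkM'⟩, hkM⟩)

lemma sum_Ioc_coeff_eq_cumSum_sub {R : Type*} [Ring R] (φ : R⟦X⟧) {M N : ℕ} (hMN : M ≤ N) :
    ∑ n ∈ Ioc M N, coeff n φ = cumSum φ N - cumSum φ M := by
  rw [← Ico_add_one_add_one_eq_Ioc, sum_Ico_eq_sub _ (Nat.add_le_add_right hMN 1), cumSum, cumSum]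

-- Having `s_k > M` is unlikely if `k` is low for `M`, and so is `s_k ≤ N` if `k` is high for `N`.
lemma sum_Ioc_deviantMass_le (hF : IsLifetimeSeries F) {δ : ℝ} (hδ0 : 0 < δ) (hδ1 : δ < 1 / 2)
    {M N : ℕ} (hMN : M ≤ N) (hM : 0 < renewalFun F M)
    (hratio : (1 - δ / 2) * renewalFun F N ≤ renewalFun F M) :
    ∑ n ∈ Ioc M N, deviantMass F δ n ≤
      momentGap F M / (δ / 4 * renewalFun F M) + momentGap F N / (δ / 4 * renewalFun F N) := by
  have hN : 0 < renewalFun F N := hM.trans_le (hF.renewalFun_mono hMN)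
  set S := lowCounts F (δ / 4) M
  set T := highCounts F (δ / 4) N
  have hcoeff : ∀ n k, 0 ≤ coeff n (F ^ k) := fun n k => coeff_pow_nonneg hF.coeff_nonneg k n
  have hsplit : ∀ n ∈ Ioc M N, deviantMass F δ n ≤
      ∑ k ∈ S, coeff n (F ^ k) + ∑ k ∈ T, coeff n (F ^ k) := by
    intro n hn
    obtain ⟨hMn, hnN⟩ := mem_Ioc.1 hn
    calc deviantMass F δ n ≤ ∑ k ∈ S ∪ T, coeff n (F ^ k) :=
          sum_le_sum_of_subset_of_nonneg (deviantCounts_subset hF hδ0 hδ1 hMn.le hnN hN hratio)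
            fun k _ _ => hcoeff n k
      _ ≤ ∑ k ∈ S, coeff n (F ^ k) + ∑ k ∈ T, coeff n (F ^ k) := by
          rw [← sum_union_inter]
          exact le_add_of_nonneg_right (sum_nonneg fun k _ => hcoeff n k)
  calc ∑ n ∈ Ioc M N, deviantMass F δ n
      ≤ ∑ n ∈ Ioc M N, (∑ k ∈ S, coeff n (F ^ k) + ∑ k ∈ T, coeff n (F ^ k)) := sum_le_sum hsplit
    _ = ∑ k ∈ S, (cumSum (F ^ k) N - cumSum (F ^ k) M) +
        ∑ k ∈ T, (cumSum (F ^ k) N - cumSum (F ^ k) M) := by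
        rw [sum_add_distrib, sum_comm, sum_comm (t := T)]
        simp_rw [sum_Ioc_coeff_eq_cumSum_sub _ hMN]
    _ ≤ ∑ k ∈ S, (1 - cumSum (F ^ k) M) + ∑ k ∈ T, cumSum (F ^ k) N := by
        gcongr with k _ k _
        · exact hF.cumSum_pow_le_one k N
        · exact sub_le_self _ (hF.cumSum_pow_nonneg k M)
    _ ≤ _ := by
        gcongr
        · rw [le_div_iff₀ (by positivity)]
          exact sum_lowCounts_mul_le_momentGap hF _ M
        · rw [le_div_iff₀ (by positivity)]
          exact sum_highCounts_mul_le_momentGap hF _ N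

lemma sum_deviantMass_div_le (hF : IsLifetimeSeries F) {δ : ℝ} (hδ0 : 0 < δ) (hδ1 : δ < 1 / 2)
    {M N : ℕ} (hMN : M ≤ N) (hM : 0 < renewalFun F M)
    (hratio : (1 - δ / 2) * renewalFun F N ≤ renewalFun F M) :
    (∑ n ∈ Icc 1 N, deviantMass F δ n) / renewalFun F N ≤
      renewalFun F M / renewalFun F N * ((∑ n ∈ Icc 1 M, deviantMass F δ n) / renewalFun F M) +
        4 / δ * (momentGap F M / renewalFun F M ^ 2 + momentGap F N / renewalFun F N ^ 2) := by
  have hmono := hF.renewalFun_mono hMN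
  have hN : 0 < renewalFun F N := hM.trans_le hmono
  have hGM := momentGap_nonneg hF M
  have hsplit : ∑ n ∈ Icc 1 N, deviantMass F δ n =
      ∑ n ∈ Icc 1 M, deviantMass F δ n + ∑ n ∈ Ioc M N, deviantMass F δ n :=
    (sum_Ioc_consecutive (deviantMass F δ) M.zero_le hMN).symm
  calc (∑ n ∈ Icc 1 N, deviantMass F δ n) / renewalFun F N
      ≤ (∑ n ∈ Icc 1 M, deviantMass F δ n + (momentGap F M / (δ / 4 * renewalFun F M) +
          momentGap F N / (δ / 4 * renewalFun F N))) / renewalFun F N := by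
        rw [hsplit]
        gcongr
        exact sum_Ioc_deviantMass_le hF hδ0 hδ1 hMN hM hratio
    _ = renewalFun F M / renewalFun F N * ((∑ n ∈ Icc 1 M, deviantMass F δ n) / renewalFun F M) +
        4 / δ * (momentGap F M / (renewalFun F M * renewalFun F N) +
          momentGap F N / renewalFun F N ^ 2) := by field_simp
    _ ≤ _ := by
        rw [sq (renewalFun F M)]
        gcongr

lemma tendsto_sum_deviantMass_div (hF : IsLifetimeSeries F) (hL : SlowlyVaryingSeq (tailSum F))
    {δ : ℝ} (hδ0 : 0 < δ) (hδ1 : δ < 1 / 2) :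
    Tendsto (fun N => (∑ n ∈ Icc 1 N, deviantMass F δ n) / renewalFun F N) atTop (𝓝 0) := by
  have hρ : 0 < 1 - δ / 4 := by linarith
  have hfloor := tendsto_floor_mul_natCast_atTop hρ
  have hratio := tendsto_renewalFun_floor_div hF hL hρ
  have hgap := tendsto_momentGap_div hF hL
  have hpos := eventually_renewalFun_pos hF hL
  have hmass : ∀ N, 0 ≤ ∑ n ∈ Icc 1 N, deviantMass F δ n := fun N =>
    sum_nonneg fun n _ => deviantMass_nonneg hF δ n
  refine tendsto_zero_of_contraction (C := 1) (ρ := 1 - δ / 8)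
    (φ := fun N : ℕ => ⌊(1 - δ / 4) * (N : ℝ)⌋₊)
    (fun N => div_nonneg (hmass N) (hF.renewalFun_nonneg N))
    (fun N => div_le_one_of_le₀ (sum_deviantMass_le_renewalFun hF δ N) (hF.renewalFun_nonneg N))
    hfloor (by linarith) (by linarith)
    (by simpa using ((hgap.comp hfloor).add hgap).const_mul (4 / δ)) ?_
  filter_upwards [hpos, hfloor.eventually hpos,
    hratio.eventually_lt_const (by linarith : 1 - δ / 4 < 1 - δ / 8),
    hratio.eventually_const_lt (by linarith : 1 - δ / 2 < 1 - δ / 4)] with N hN hM hlt hgt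
  rw [lt_div_iff₀ hN] at hgt
  refine (sum_deviantMass_div_le hF hδ0 hδ1 (floor_mul_natCast_le (by linarith) N) hM hgt.le).trans
    ?_
  have := div_nonneg (hmass ⌊(1 - δ / 4) * (N : ℝ)⌋₊) hM.le
  gcongr

end Concentration

section CesaroTest

variable {F : ℝ⟦X⟧} {g : ℝ → ℝ} {C : ℝ}

lemma IsLifetimeSeries.coeff_pow_le_renewalFun (hF : IsLifetimeSeries F) {k n : ℕ}
    (hk : k ∈ Icc 1 n) : coeff n (F ^ k) ≤ renewalFun F n := by
  calc coeff n (F ^ k) ≤ cumSum (F ^ k) n :=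
        single_le_sum (f := fun i => coeff i (F ^ k))
          (fun i _ => coeff_pow_nonneg hF.coeff_nonneg k i) (self_mem_range_succ n)
    _ ≤ ∑ k ∈ Icc 1 n, cumSum (F ^ k) n :=
        single_le_sum (f := fun k => cumSum (F ^ k) n) (fun k _ => hF.cumSum_pow_nonneg k n) hk
    _ = renewalFun F n := sum_Icc_cumSum_pow hF.constantCoeff_eq_zero n

lemma abs_test_sub_le (hC : ∀ x, 0 < x → |g x| ≤ C) {ε δ a : ℝ} (hε : 0 ≤ ε)
    (hg : ∀ x, |x - 1| < δ → |g x - g 1| ≤ ε) (ha : 0 < a) {k : ℝ} (hk : 0 < k) :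
    |g (k / a) - g 1| ≤ ε + if δ * a ≤ |k - a| then 2 * C else 0 := by
  split_ifs with hdev
  · have := abs_sub (g (k / a)) (g 1)
    linarith [hC _ (div_pos hk ha), hC 1 one_pos]
  · rw [add_zero]
    refine hg _ ?_
    rwa [div_sub_one ha.ne', abs_div, abs_of_pos ha, div_lt_iff₀ ha, ← not_le]

lemma abs_sum_test_sub_le (hF : IsLifetimeSeries F) (hC : ∀ x, 0 < x → |g x| ≤ C) {ε δ : ℝ}
    (hε : 0 ≤ ε) (hg : ∀ x, |x - 1| < δ → |g x - g 1| ≤ ε) (n : ℕ) :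
    |∑ k ∈ Icc 1 n, g (k / renewalFun F n) * coeff n (F ^ k) - g 1 * coeff n (renewalSeries F)| ≤
      ε * coeff n (renewalSeries F) + 2 * C * deviantMass F δ n := by
  rw [← sum_Icc_coeff_pow hF.constantCoeff_eq_zero, deviantMass, deviantCounts, sum_filter,
    mul_sum, ← sum_sub_distrib, mul_sum, mul_sum, ← sum_add_distrib]
  refine (abs_sum_le_sum_abs _ _).trans (sum_le_sum fun k hk => ?_)
  have hcoeff := coeff_pow_nonneg hF.coeff_nonneg k n
  rw [← sub_mul, abs_mul, abs_of_nonneg hcoeff]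
  rcases (hF.renewalFun_nonneg n).eq_or_lt with ha | ha
  · have hzero : coeff n (F ^ k) = 0 :=
      le_antisymm ((hF.coeff_pow_le_renewalFun hk).trans_eq ha.symm) hcoeff
    simp [hzero]
  · calc |g (k / renewalFun F n) - g 1| * coeff n (F ^ k)
        ≤ (ε + if δ * renewalFun F n ≤ |k - renewalFun F n| then 2 * C else 0) *
            coeff n (F ^ k) := by
          gcongr
          exact abs_test_sub_le hC hε hg ha (Nat.cast_pos.2 (mem_Icc.1 hk).1)
      _ = _ := by split_ifs <;> ring

lemma tendsto_cesaro_abs_test (hF : IsLifetimeSeries F) (hL : SlowlyVaryingSeq (tailSum F))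
    (hC : ∀ x, 0 < x → |g x| ≤ C) (hg : ContinuousAt g 1) :
    Tendsto (fun N : ℕ => (1 / renewalFun F N) * ∑ n ∈ Icc 1 N,
      |∑ k ∈ Icc 1 n, g (k / renewalFun F n) * coeff n (F ^ k) -
        g 1 * coeff n (renewalSeries F)|) atTop (𝓝 0) := by
  refine tendsto_order.2 ⟨fun b hb => Eventually.of_forall fun n => hb.trans_le
    (mul_nonneg (one_div_nonneg.2 (hF.renewalFun_nonneg n)) (sum_nonneg fun _ _ => abs_nonneg _)),
    fun b hb => ?_⟩
  obtain ⟨δ₀, hδ₀, hδg⟩ := Metric.continuousAt_iff.1 hg (b / 2) (half_pos hb)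
  set δ := min δ₀ (1 / 4)
  have hδ : 0 < δ := by positivity
  have hδ' : δ < 1 / 2 := (min_le_right _ _).trans_lt (by norm_num)
  have hgδ : ∀ x, |x - 1| < δ → |g x - g 1| ≤ b / 2 := fun x hx =>
    (hδg (hx.trans_le (min_le_left _ _))).le
  have hlim := (tendsto_sum_deviantMass_div hF hL hδ hδ').const_mul (2 * C)
  rw [mul_zero] at hlim
  filter_upwards [eventually_renewalFun_pos hF hL, hlim.eventually_lt_const (half_pos hb)]
    with N hN hsmall
  calc _ ≤ 1 / renewalFun F N * ∑ n ∈ Icc 1 N,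
          (b / 2 * coeff n (renewalSeries F) + 2 * C * deviantMass F δ n) := by
        gcongr
        exact abs_sum_test_sub_le hF hC (half_pos hb).le hgδ _
    _ = b / 2 + 2 * C * ((∑ n ∈ Icc 1 N, deviantMass F δ n) / renewalFun F N) := by
        rw [sum_add_distrib, ← mul_sum, ← mul_sum,
          sum_Icc_coeff_renewalSeries hF.constantCoeff_eq_zero]
        field_simp
    _ < b := by linarith

end CesaroTest

section Lifetimes

variable {Ω : Type*} [MeasurableSpace Ω] {P : Measure Ω} {X Y : Ω → ℕ} {ξ : ℕ → Ω → ℕ}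

/-- The generating series of the law of an `ℕ`-valued random variable. -/
noncomputable def genSeries (P : Measure Ω) (X : Ω → ℕ) : ℝ⟦X⟧ :=
  PowerSeries.mk fun n => P.real {ω | X ω = n}

lemma coeff_genSeries (P : Measure Ω) (X : Ω → ℕ) (n : ℕ) :
    coeff n (genSeries P X) = P.real {ω | X ω = n} :=
  coeff_mk n _

lemma genSeries_eq_of_identDistrib (h : IdentDistrib X Y P P) : genSeries P X = genSeries P Y := by
  ext n
  rw [coeff_genSeries, coeff_genSeries, measureReal_def, measureReal_def]
  exact congrArg ENNReal.toReal (h.measure_mem_eq (measurableSet_singleton n))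

lemma genSeries_zero [IsProbabilityMeasure P] : genSeries P 0 = 1 := by
  ext n
  rcases eq_or_ne n 0 with rfl | hn
  · simp [coeff_genSeries]
  · simp [coeff_genSeries, coeff_one, hn, hn.symm]

lemma genSeries_add [IsFiniteMeasure P] (hX : Measurable X) (hY : Measurable Y)
    (h : IndepFun X Y P) : genSeries P (X + Y) = genSeries P X * genSeries P Y := by
  ext n
  have hunion : {ω | (X + Y) ω = n} =
      ⋃ p ∈ HasAntidiagonal.antidiagonal n, X ⁻¹' {p.1} ∩ Y ⁻¹' {p.2} := by
    ext ω
    simp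
  have hdisj : Set.PairwiseDisjoint (↑(HasAntidiagonal.antidiagonal n))
      fun p : ℕ × ℕ => X ⁻¹' {p.1} ∩ Y ⁻¹' {p.2} := fun p _ q _ hpq =>
    Set.disjoint_left.2 fun ω hp hq =>
      hpq (Prod.ext (hp.1.symm.trans hq.1) (hp.2.symm.trans hq.2))
  rw [coeff_mul, coeff_genSeries, hunion, measureReal_biUnion_finset hdisj fun p _ =>
    (hX (measurableSet_singleton p.1)).inter (hY (measurableSet_singleton p.2))]
  refine sum_congr rfl fun p _ => ?_
  rw [coeff_genSeries, coeff_genSeries, measureReal_def, h.measure_inter_preimage_eq_mul _ _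
    (measurableSet_singleton p.1) (measurableSet_singleton p.2), ENNReal.toReal_mul]
  rfl

lemma partialSum_eq_sum {α : Type*} (ξ : ℕ → α → ℕ) (k : ℕ) :
    partialSum ξ k = ∑ i ∈ range k, ξ i := by
  ext ω
  rw [partialSum, Finset.sum_apply]

lemma genSeries_partialSum [IsProbabilityMeasure P] (hmeas : ∀ i, Measurable (ξ i))
    (hindep : iIndepFun ξ P) (hident : ∀ i, IdentDistrib (ξ i) (ξ 0) P P) (k : ℕ) :
    genSeries P (partialSum ξ k) = genSeries P (ξ 0) ^ k := by
  rw [partialSum_eq_sum]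
  induction k with
  | zero => simpa using genSeries_zero
  | succ k ih =>
    have hsum : Measurable (∑ i ∈ range k, ξ i) :=
      partialSum_eq_sum ξ k ▸ Finset.measurable_fun_sum _ fun i _ => hmeas i
    rw [sum_range_succ, genSeries_add hsum (hmeas k) (hindep.indepFun_sum_range_succ hmeas k), ih,
      genSeries_eq_of_identDistrib (hident k), pow_succ]

lemma cumSum_genSeries [IsFiniteMeasure P] (hX : Measurable X) (n : ℕ) :
    cumSum (genSeries P X) n = P.real {ω | X ω ≤ n} := by
  have hset : {ω | X ω ≤ n} = X ⁻¹' (range (n + 1) : Finset ℕ) := by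
    ext ω
    simp
  rw [hset, ← sum_measureReal_preimage_singleton _ fun i _ => hX (measurableSet_singleton i)]
  exact sum_congr rfl fun i _ => coeff_genSeries P X i

lemma constantCoeff_genSeries (hpos : ∀ᵐ ω ∂P, 1 ≤ X ω) : constantCoeff (genSeries P X) = 0 := by
  rw [← coeff_zero_eq_constantCoeff_apply, coeff_genSeries, measureReal_def]
  have hnull : P {ω | X ω = 0} = 0 := by
    simpa [ae_iff, Nat.one_le_iff_ne_zero] using hpos
  simp [hnull]

lemma isLifetimeSeries_genSeries [IsProbabilityMeasure P] (hX : Measurable X)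
    (hpos : ∀ᵐ ω ∂P, 1 ≤ X ω) : IsLifetimeSeries (genSeries P X) where
  constantCoeff_eq_zero := constantCoeff_genSeries hpos
  coeff_nonneg n := measureReal_nonneg.trans_eq (coeff_genSeries P X n).symm
  cumSum_le_one n := (cumSum_genSeries hX n).trans_le measureReal_le_one

lemma integrable_min_natCast [IsFiniteMeasure P] (hX : Measurable X) (t : ℝ) :
    Integrable (fun ω => min (X ω : ℝ) t) P := by
  refine Integrable.of_bound (C := |t|)
    ((measurable_from_nat.comp hX).min measurable_const).aestronglyMeasurable
    (ae_of_all _ fun ω => abs_le.2 ⟨?_, (min_le_right _ _).trans (le_abs_self t)⟩)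
  exact le_min ((neg_nonpos.2 (abs_nonneg t)).trans (X ω).cast_nonneg) (neg_abs_le t)

lemma truncatedMean_mono [IsFiniteMeasure P] (hX : Measurable X) :
    Monotone (truncatedMean P X) := fun _ _ h =>
  integral_mono (integrable_min_natCast hX _) (integrable_min_natCast hX _)
    fun _ => min_le_min_left _ h

lemma min_natCast_eq_sum_indicator {α : Type*} (X : α → ℕ) (n : ℕ) (ω : α) :
    min (X ω : ℝ) n = ∑ m ∈ range n, {ω | X ω ≤ m}ᶜ.indicator 1 ω := by
  have hfilter : {m ∈ range n | m < X ω} = range (min (X ω) n) := by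
    ext m
    simp only [mem_filter, mem_range]
    omega
  simp [Set.indicator_apply, ← Nat.cast_min, hfilter]

lemma truncatedMean_natCast [IsProbabilityMeasure P] (hX : Measurable X) (n : ℕ) :
    truncatedMean P X n = tailSum (genSeries P X) n := by
  have hmeas : ∀ m : ℕ, MeasurableSet {ω | X ω ≤ m} := fun m => hX measurableSet_Iic
  simp_rw [truncatedMean, min_natCast_eq_sum_indicator]
  rw [integral_finsetSum _ fun m _ => (integrable_const 1).indicator (hmeas m).compl]
  refine sum_congr rfl fun m _ => ?_
  rw [integral_indicator_one (hmeas m).compl, probReal_compl_eq_one_sub (hmeas m),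
    cumSum_genSeries hX]

lemma slowlyVaryingSeq_tailSum_genSeries [IsProbabilityMeasure P] (hX : Measurable X)
    (hslow : IsSlowlyVarying (truncatedMean P X)) : SlowlyVaryingSeq (tailSum (genSeries P X)) := by
  simpa only [truncatedMean_natCast hX] using
    slowlyVaryingSeq_of_isSlowlyVarying (truncatedMean_mono hX) hslow

lemma hitProb_eq_coeff [IsProbabilityMeasure P] (hmeas : ∀ i, Measurable (ξ i))
    (hindep : iIndepFun ξ P) (hident : ∀ i, IdentDistrib (ξ i) (ξ 0) P P) (k n : ℕ) :
    hitProb P ξ k n = coeff n (genSeries P (ξ 0) ^ k) := by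
  rw [hitProb, ← coeff_genSeries, genSeries_partialSum hmeas hindep hident]

lemma renewalSeq_eq_coeff [IsProbabilityMeasure P] (hmeas : ∀ i, Measurable (ξ i))
    (hindep : iIndepFun ξ P) (hident : ∀ i, IdentDistrib (ξ i) (ξ 0) P P)
    (hpos : ∀ᵐ ω ∂P, 1 ≤ ξ 0 ω) (n : ℕ) :
    renewalSeq P ξ n = coeff n (renewalSeries (genSeries P (ξ 0))) := by
  simp_rw [renewalSeq, hitProb_eq_coeff hmeas hindep hident]
  exact sum_Icc_coeff_pow (constantCoeff_genSeries hpos) n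

lemma returnSeq_eq_renewalFun [IsProbabilityMeasure P] (hmeas : ∀ i, Measurable (ξ i))
    (hindep : iIndepFun ξ P) (hident : ∀ i, IdentDistrib (ξ i) (ξ 0) P P)
    (hpos : ∀ᵐ ω ∂P, 1 ≤ ξ 0 ω) (n : ℕ) :
    returnSeq P ξ n = renewalFun (genSeries P (ξ 0)) n := by
  simp_rw [returnSeq, renewalSeq_eq_coeff hmeas hindep hident hpos]
  exact sum_Icc_coeff_renewalSeries (constantCoeff_genSeries hpos) n

end Lifetimes

end Renewal

theorem corollary7_general {Ω : Type*} [MeasurableSpace Ω] {P : Measure Ω} [IsProbabilityMeasure P]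
    {ξ : ℕ → Ω → ℕ} (hmeas : ∀ i, Measurable (ξ i)) (hpos : ∀ᵐ ω ∂P, 1 ≤ ξ 0 ω)
    (hindep : iIndepFun ξ P) (hident : ∀ i, IdentDistrib (ξ i) (ξ 0) P P)
    (hslow : IsSlowlyVarying (Renewal.truncatedMean P (ξ 0))) :
    (Renewal.returnSeq P ξ ~[atTop] fun n : ℕ => (n : ℝ) / Renewal.truncatedMean P (ξ 0) n) ∧
    ∀ g : ℝ → ℝ, ContinuousAt g 1 → (∃ C : ℝ, ∀ x, 0 < x → |g x| ≤ C) →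
      Tendsto (fun N : ℕ => (1 / Renewal.returnSeq P ξ N) *
          ∑ n ∈ Finset.Icc 1 N,
            |(∑ k ∈ Finset.Icc 1 n,
                g ((k : ℝ) / Renewal.returnSeq P ξ n) * Renewal.hitProb P ξ k n)
              - g 1 * Renewal.renewalSeq P ξ n|)
        atTop (𝓝 0) := by
  have hF := Renewal.isLifetimeSeries_genSeries (hmeas 0) hpos
  have hL := Renewal.slowlyVaryingSeq_tailSum_genSeries (hmeas 0) hslow
  rw [funext (Renewal.returnSeq_eq_renewalFun hmeas hindep hident hpos)]
  simp_rw [Renewal.renewalSeq_eq_coeff hmeas hindep hident hpos,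
    Renewal.hitProb_eq_coeff hmeas hindep hident, Renewal.truncatedMean_natCast (hmeas 0)]
  exact ⟨Renewal.isEquivalent_renewalFun hF hL,
    fun g hg ⟨_, hC⟩ => Renewal.tendsto_cesaro_abs_test hF hL hC hg⟩

theorem corollary7 {Ω : Type*} [MeasurableSpace Ω] (P : Measure Ω) [IsProbabilityMeasure P]
    (ξ : ℕ → Ω → ℕ) (hmeas : ∀ i, Measurable (ξ i)) (hpos : ∀ i, ∀ᵐ ω ∂P, 1 ≤ ξ i ω)
    (hindep : iIndepFun ξ P) (hident : ∀ i, IdentDistrib (ξ i) (ξ 0) P P)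
    (hslow : IsSlowlyVarying (Renewal.truncatedMean P (ξ 0))) :
    ((fun n : ℕ => Renewal.returnSeq P ξ n) ~[atTop]
      fun n : ℕ => (n : ℝ) / Renewal.truncatedMean P (ξ 0) (n : ℝ)) ∧
    ∀ g : ℝ → ℝ, ContinuousOn g (Set.Ioi 0) → (∃ C : ℝ, ∀ x, 0 < x → |g x| ≤ C) →
      Tendsto (fun N : ℕ => (1 / Renewal.returnSeq P ξ N) *
          ∑ n ∈ Finset.Icc 1 N,
            |(∑ k ∈ Finset.Icc 1 n,
                g ((k : ℝ) / Renewal.returnSeq P ξ n) * Renewal.hitProb P ξ k n)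
              - g 1 * Renewal.renewalSeq P ξ n|)
        atTop (𝓝 0) := by
  have h := corollary7_general hmeas (hpos 0) hindep hident hslow
  exact ⟨h.1, fun g hg hC => h.2 g (hg.continuousAt (Ioi_mem_nhds one_pos)) hC⟩
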